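/- Let $f(x)$ be a real polynomial of degree $k\ge 1$ with irrational leading coefficient, let $\gamma=4^{1-k}$, and write $\|x\|$ for the distance of the real number $x$ from the nearest integer. Let $\varepsilon>0$. Then there are infinitely many positive integers $n$ having at least three positive divisors such that $$\|f(n)\|<n^{-\gamma/4+\varepsilon}.$$ -/

import Mathlib

/-- The distance `‖x‖` of a real number `x` from the nearest integer. -/
noncomputable def distNearestInt (x : ℝ) : ℝ := |x - (round x : ℝ)|

/-- The exponent `γ = 4 ^ (1 - k)` attached to the degree `k`; the power is an integer power. -/
noncomputable def gammaExp (k : ℕ) : ℝ := (4 : ℝ) ^ (1 - (k : ℤ))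

/-! Every even `n ≥ 4` has the divisors `1, 2, n`, so no primes or sieve are needed: it suffices to
make `g(m) = f(2m + 2M)` small mod 1, and `g` still has irrational leading coefficient `α`.

Let `k + 1` be the degree. Dirichlet gives denominators `q → ∞` with `|α - a/q| < 1/q²`, so small
multiples of `α` stay `1/(2q)` away from the integers. Weyl differencing (`norm_weylSum_mul_le`)
then bounds the sums of `e(h g(n))` for `0 < |h| < H`, and a Fejér mean square
(`exists_sq_distNearestInt_mul_lt`) yields `‖g(m)‖ < H^(-1/2)` with `m ≪ H^D`, `D = 3·2^k - 1`.
Since `2D ≤ 4^(k+1)`, this beats the required exponent once `ε` is used. -/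

open Finset Complex ComplexConjugate

/-- The additive character `x ↦ exp (2 π i x)` of `ℝ / ℤ`. -/
noncomputable def expTwoPiI (x : ℝ) : ℂ := Complex.exp (((2 * Real.pi * x : ℝ) : ℂ) * I)

lemma norm_expTwoPiI (x : ℝ) : ‖expTwoPiI x‖ = 1 := Complex.norm_exp_ofReal_mul_I _

lemma expTwoPiI_add (x y : ℝ) : expTwoPiI (x + y) = expTwoPiI x * expTwoPiI y := by
  unfold expTwoPiI
  rw [← Complex.exp_add]
  push_cast
  ring_nf

lemma conj_expTwoPiI (x : ℝ) : conj (expTwoPiI x) = expTwoPiI (-x) := by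
  unfold expTwoPiI
  rw [← Complex.exp_conj, map_mul, Complex.conj_ofReal, Complex.conj_I]
  push_cast
  ring_nf

lemma expTwoPiI_zero : expTwoPiI 0 = 1 := by simp [expTwoPiI]

lemma expTwoPiI_sub (x y : ℝ) : expTwoPiI (x - y) = expTwoPiI x * conj (expTwoPiI y) := by
  rw [conj_expTwoPiI, ← expTwoPiI_add, sub_eq_add_neg]

lemma expTwoPiI_nat_mul (n : ℕ) (x : ℝ) : expTwoPiI (n * x) = expTwoPiI x ^ n := by
  unfold expTwoPiI
  rw [← Complex.exp_nat_mul]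
  push_cast
  ring_nf

lemma expTwoPiI_intCast (z : ℤ) : expTwoPiI z = 1 := by
  unfold expTwoPiI
  rw [Complex.exp_eq_one_iff]
  exact ⟨z, by push_cast; ring⟩

lemma distNearestInt_nonneg (x : ℝ) : 0 ≤ distNearestInt x := abs_nonneg _

lemma distNearestInt_le_half (x : ℝ) : distNearestInt x ≤ 1 / 2 := abs_sub_round x

/-- Reduce to `|y| ≤ 1/2`, where `|e(y) - 1| = 2 sin(π|y|)`, and apply Jordan's inequality. -/
lemma four_mul_distNearestInt_le (x : ℝ) : 4 * distNearestInt x ≤ ‖expTwoPiI x - 1‖ := by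
  set y : ℝ := x - round x with hy
  have h1 : expTwoPiI x = expTwoPiI y := by
    have : x = y + (round x : ℤ) := by rw [hy]; ring
    rw [this, expTwoPiI_add, expTwoPiI_intCast, mul_one]
  have hd : distNearestInt x = |y| := rfl
  have hyhalf : |y| ≤ 1 / 2 := abs_sub_round x
  rw [h1, hd]
  have h2 : ‖expTwoPiI y - 1‖ = ‖2 * Real.sin (2 * Real.pi * y / 2)‖ := by
    rw [← Complex.norm_exp_I_mul_ofReal_sub_one, expTwoPiI, mul_comm]
  have h3 : 2 * Real.pi * y / 2 = Real.pi * y := by ring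
  rw [h2, h3, norm_mul, Real.norm_eq_abs, Real.norm_eq_abs, abs_two]
  have hpi := Real.pi_pos
  have h4 : |Real.sin (Real.pi * y)| = Real.sin (Real.pi * |y|) := by
    have : |Real.pi * y| = Real.pi * |y| := by rw [abs_mul, abs_of_pos hpi]
    rw [Real.abs_sin_eq_sin_abs_of_abs_le_pi, this]
    rw [this]
    nlinarith [abs_nonneg y]
  rw [h4]
  have h5 := Real.mul_le_sin (x := Real.pi * |y|) (by positivity) (by nlinarith)
  have h6 : 2 / Real.pi * (Real.pi * |y|) = 2 * |y| := by field_simp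
  linarith

/-- The bound for a linear exponential sum. -/
lemma distNearestInt_mul_norm_sum_linear_le (β c : ℝ) (N : ℕ) :
    2 * distNearestInt β * ‖∑ n ∈ range N, expTwoPiI (n * β + c)‖ ≤ 1 := by
  have h1 : ∑ n ∈ range N, expTwoPiI (n * β + c)
      = (∑ n ∈ range N, expTwoPiI β ^ n) * expTwoPiI c := by
    rw [Finset.sum_mul]
    refine Finset.sum_congr rfl fun n _ => ?_
    rw [expTwoPiI_add, expTwoPiI_nat_mul]
  rw [h1, norm_mul, norm_expTwoPiI, mul_one]
  have h2 := geom_sum_mul (expTwoPiI β) N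
  have h3 : ‖∑ n ∈ range N, expTwoPiI β ^ n‖ * ‖expTwoPiI β - 1‖ ≤ 2 := by
    rw [← norm_mul, h2]
    refine (norm_sub_le _ _).trans ?_
    rw [norm_pow, norm_expTwoPiI]
    norm_num
  nlinarith [four_mul_distNearestInt_le β, norm_nonneg (∑ n ∈ range N, expTwoPiI β ^ n)]

/-! ### Mean squares and van der Corput differencing -/

/-- The mean square of short sums: the off-diagonal correlations control the deviation from the
diagonal contribution. -/
lemma abs_sum_norm_sq_sub_le (v : ℕ → ℕ → ℝ) (N H : ℕ) (B : ℝ) (hB : 0 ≤ B)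
    (h : ∀ j < H, ∀ l < H, j ≠ l → ‖∑ n ∈ range N, expTwoPiI (v n j - v n l)‖ ≤ B) :
    |∑ n ∈ range N, ‖∑ j ∈ range H, expTwoPiI (v n j)‖ ^ 2 - H * N| ≤ H ^ 2 * B := by
  have key : (((∑ n ∈ range N, ‖∑ j ∈ range H, expTwoPiI (v n j)‖ ^ 2 - H * N : ℝ)) : ℂ)
      = ∑ j ∈ range H, ∑ l ∈ range H,
        if j = l then 0 else ∑ n ∈ range N, expTwoPiI (v n j - v n l) := by
    have h1 : ((∑ n ∈ range N, ‖∑ j ∈ range H, expTwoPiI (v n j)‖ ^ 2 : ℝ) : ℂ)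
        = ∑ j ∈ range H, ∑ l ∈ range H, ∑ n ∈ range N, expTwoPiI (v n j - v n l) := by
      push_cast
      have : ∀ n ∈ range N, ((‖∑ j ∈ range H, expTwoPiI (v n j)‖ : ℂ)) ^ 2
          = ∑ j ∈ range H, ∑ l ∈ range H, expTwoPiI (v n j - v n l) := by
        intro n _
        rw [← Complex.mul_conj', map_sum, Finset.sum_mul_sum]
        simp only [expTwoPiI_sub]
      rw [Finset.sum_congr rfl this, Finset.sum_comm]
      refine Finset.sum_congr rfl fun j _ => Finset.sum_comm
    have h2 : ((H : ℂ) * N) = ∑ j ∈ range H, ∑ l ∈ range H, if j = l then (N : ℂ) else 0 := by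
      have : ∀ j ∈ range H, ∑ l ∈ range H, (if j = l then (N : ℂ) else 0) = N := by
        intro j hj
        rw [Finset.sum_ite_eq, if_pos hj]
      rw [Finset.sum_congr rfl this]
      simp
    rw [Complex.ofReal_sub, h1]
    push_cast
    rw [h2, ← Finset.sum_sub_distrib]
    refine Finset.sum_congr rfl fun j _ => ?_
    rw [← Finset.sum_sub_distrib]
    refine Finset.sum_congr rfl fun l _ => ?_
    split_ifs with hjl
    · subst hjl
      simp [expTwoPiI_zero]
    · simp
  rw [← Real.norm_eq_abs, ← Complex.norm_real, key]
  have hsum : (H : ℝ) ^ 2 * B = ∑ _j ∈ range H, ∑ _l ∈ range H, B := by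
    simp [sq, mul_assoc]
  rw [hsum]
  refine norm_sum_le_of_le _ fun j hj => norm_sum_le_of_le _ fun l hl => ?_
  split_ifs with hjl
  · simpa using hB
  · exact h j (mem_range.1 hj) l (mem_range.1 hl) hjl

/-- Shifting the range of a sum of unimodular terms. -/
lemma norm_sum_shift_sub_le (u : ℕ → ℝ) (N j : ℕ) :
    ‖∑ n ∈ range N, expTwoPiI (u (n + j)) - ∑ n ∈ range N, expTwoPiI (u n)‖ ≤ 2 * j := by
  induction j with
  | zero => simp
  | succ j ih =>
    have h1 := Finset.sum_range_succ' (fun n => expTwoPiI (u (n + j))) N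
    have h2 := Finset.sum_range_succ (fun n => expTwoPiI (u (n + j))) N
    have h3 : ∑ n ∈ range N, expTwoPiI (u (n + (j + 1)))
        = ∑ n ∈ range N, expTwoPiI (u (n + 1 + j)) :=
      Finset.sum_congr rfl fun n _ => by rw [add_assoc n 1 j, add_comm 1 j]
    have h4 : ∑ n ∈ range N, expTwoPiI (u (n + (j + 1))) - ∑ n ∈ range N, expTwoPiI (u n)
        = (∑ n ∈ range N, expTwoPiI (u (n + j)) - ∑ n ∈ range N, expTwoPiI (u n))
          + (expTwoPiI (u (N + j)) - expTwoPiI (u (0 + j))) := by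
      rw [h3]
      linear_combination h2 - h1
    rw [h4]
    refine (norm_add_le _ _).trans ?_
    have h5 := norm_sub_le (expTwoPiI (u (N + j))) (expTwoPiI (u (0 + j)))
    rw [norm_expTwoPiI, norm_expTwoPiI] at h5
    push_cast
    linarith

/-- Van der Corput's inequality. -/
lemma vanDerCorput (u : ℕ → ℝ) (N H : ℕ) (B : ℝ) (hB : 0 ≤ B)
    (h : ∀ j < H, ∀ l < H, j ≠ l → ‖∑ n ∈ range N, expTwoPiI (u (n + j) - u (n + l))‖ ≤ B) :
    ∃ T : ℝ, 0 ≤ T ∧ T ^ 2 ≤ N * (H * N + H ^ 2 * B) ∧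
      H * ‖∑ n ∈ range N, expTwoPiI (u n)‖ ≤ T + H ^ 2 := by
  refine ⟨‖∑ n ∈ range N, ∑ j ∈ range H, expTwoPiI (u (n + j))‖, norm_nonneg _, ?_, ?_⟩
  · have h1 := (abs_le.1 (abs_sum_norm_sq_sub_le (fun n j => u (n + j)) N H B hB h)).2
    have h2 : (∑ n ∈ range N, ‖∑ j ∈ range H, expTwoPiI (u (n + j))‖) ^ 2
        ≤ N * ∑ n ∈ range N, ‖∑ j ∈ range H, expTwoPiI (u (n + j))‖ ^ 2 := by
      simpa using sq_sum_le_card_mul_sum_sq (s := range N)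
        (f := fun n => ‖∑ j ∈ range H, expTwoPiI (u (n + j))‖)
    calc _ ≤ (∑ n ∈ range N, ‖∑ j ∈ range H, expTwoPiI (u (n + j))‖) ^ 2 := by
          gcongr
          exact norm_sum_le _ _
      _ ≤ _ := h2
      _ ≤ _ := by
          gcongr
          linarith
  · have h1 : (H : ℂ) * ∑ n ∈ range N, expTwoPiI (u n)
        = ∑ n ∈ range N, ∑ j ∈ range H, expTwoPiI (u (n + j))
          - ∑ j ∈ range H, (∑ n ∈ range N, expTwoPiI (u (n + j))
            - ∑ n ∈ range N, expTwoPiI (u n)) := by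
      rw [Finset.sum_comm, Finset.sum_sub_distrib]
      simp
    have h2 : ‖∑ j ∈ range H, (∑ n ∈ range N, expTwoPiI (u (n + j))
            - ∑ n ∈ range N, expTwoPiI (u n))‖ ≤ (H : ℝ) ^ 2 := by
      refine (norm_sum_le_of_le _ fun j _ => norm_sum_shift_sub_le u N j).trans ?_
      rw [← Finset.mul_sum, ← Nat.cast_sum]
      have := Finset.sum_range_id_mul_two H
      have h3 : 2 * ∑ j ∈ range H, j ≤ H ^ 2 := by
        rw [mul_comm, this, sq]
        exact Nat.mul_le_mul_left _ (Nat.sub_le _ _)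
      exact_mod_cast h3
    have h4 := norm_mul (H : ℂ) (∑ n ∈ range N, expTwoPiI (u n))
    rw [Complex.norm_natCast, h1] at h4
    rw [← h4]
    exact (norm_sub_le _ _).trans (by linarith)

/-- Differencing lowers the degree: the Hasse derivatives of order above `k` are constant, so their
values at `a` and `b` cancel. -/
lemma Polynomial.taylor_sub_taylor_natDegree_le (p : Polynomial ℝ) (k : ℕ)
    (hp : p.natDegree ≤ k + 1) (a b : ℝ) :
    (Polynomial.taylor a p - Polynomial.taylor b p).natDegree ≤ k := by
  rw [Polynomial.natDegree_le_iff_coeff_eq_zero]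
  intro n hn
  rw [Polynomial.coeff_sub, Polynomial.taylor_coeff, Polynomial.taylor_coeff]
  have h0 : (Polynomial.hasseDeriv n p).natDegree = 0 := by
    have := Polynomial.natDegree_hasseDeriv_le p n
    omega
  rw [Polynomial.eq_C_of_natDegree_eq_zero h0]
  simp

lemma Polynomial.taylor_sub_taylor_coeff (p : Polynomial ℝ) (k : ℕ)
    (hp : p.natDegree ≤ k + 1) (a b : ℝ) :
    (Polynomial.taylor a p - Polynomial.taylor b p).coeff k
      = (k + 1) * (a - b) * p.coeff (k + 1) := by
  rw [Polynomial.coeff_sub, Polynomial.taylor_coeff, Polynomial.taylor_coeff]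
  have h1 : (Polynomial.hasseDeriv k p).natDegree < 2 := by
    have := Polynomial.natDegree_hasseDeriv_le p k
    omega
  rw [Polynomial.eval_eq_sum_range' h1, Polynomial.eval_eq_sum_range' h1]
  simp [Finset.sum_range_succ, Polynomial.hasseDeriv_coeff, add_comm 1 k]
  ring

/-! ### Weyl's inequality -/

/-- Weyl's inequality for a polynomial whose leading coefficient has no small multiple close to an
integer. -/
theorem norm_weylSum_mul_le (k : ℕ) : ∀ (H N : ℕ) (Q : ℝ) (p : Polynomial ℝ), 1 ≤ H →
    p.natDegree ≤ k + 1 →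
    (∀ m : ℤ, m ≠ 0 → |m| ≤ ((k + 1).factorial * H ^ (2 ^ (k + 1) - 2) : ℕ) →
      1 ≤ Q * distNearestInt (m * p.coeff (k + 1))) →
    (H : ℝ) ^ 2 ^ k ≤ Q → Q * (H : ℝ) ^ 2 ^ k ≤ N →
    ‖∑ n ∈ range N, expTwoPiI (p.eval (n : ℝ))‖ * H ≤ (2 * k + 1) * N := by
  induction k with
  | zero =>
    intro H N Q p hH hp hm hQ hN
    have h1 := hm 1 one_ne_zero (by simp)
    have h2 : ∀ n ∈ range N, expTwoPiI (p.eval (n : ℝ))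
        = expTwoPiI (n * p.coeff 1 + p.coeff 0) := by
      intro n _
      rw [Polynomial.eval_eq_sum_range' (show p.natDegree < 2 by omega)]
      simp [Finset.sum_range_succ]
      ring_nf
    rw [Finset.sum_congr rfl h2]
    have h3 := distNearestInt_mul_norm_sum_linear_le (p.coeff 1) (p.coeff 0) N
    set S := ‖∑ n ∈ range N, expTwoPiI (n * p.coeff 1 + p.coeff 0)‖
    have hS : 0 ≤ S := norm_nonneg _
    simp only [Int.cast_one, one_mul, zero_add] at h1
    simp only [pow_zero, pow_one] at hQ hN
    have hQ0 : 0 ≤ Q := le_trans (by positivity) hQ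
    have h4 : S ≤ Q := by
      nlinarith [mul_le_mul_of_nonneg_right h1 hS, mul_le_mul_of_nonneg_left h3 hQ0]
    have hH0 : (0 : ℝ) ≤ H := by positivity
    have := mul_le_mul_of_nonneg_right h4 hH0
    push_cast
    linarith
  | succ k ih =>
    intro H N Q p hH hp hm hQ hN
    have hH1 : (1 : ℝ) ≤ H := by exact_mod_cast hH
    have hH0 : (0 : ℝ) < H := by linarith
    have hpow : ((H ^ 2 : ℕ) : ℝ) ^ 2 ^ k = (H : ℝ) ^ 2 ^ (k + 1) := by
      push_cast
      rw [← pow_mul, pow_succ' 2 k]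
    have hcorr : ∀ j < H ^ 2, ∀ l < H ^ 2, j ≠ l →
        ‖∑ n ∈ range N, expTwoPiI (p.eval ((n + j : ℕ) : ℝ) - p.eval ((n + l : ℕ) : ℝ))‖
          ≤ (2 * k + 1) * N / (H : ℝ) ^ 2 := by
      intro j hj l hl hjl
      -- Van der Corput costs a square root, so a saving of `H` requires correlations that save `H ^
      -- 2`.
      have h := ih (H ^ 2) N Q (Polynomial.taylor (j : ℝ) p - Polynomial.taylor (l : ℝ) p)
        (Nat.one_le_pow _ _ hH) (Polynomial.taylor_sub_taylor_natDegree_le p (k + 1) hp _ _) ?_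
        (hpow ▸ hQ) (hpow ▸ hN)
      · rw [le_div_iff₀ (by positivity)]
        simpa [Polynomial.taylor_eval, add_comm] using h
      · intro m hm0 hmle
        have hjl' : (j : ℤ) - l ≠ 0 := by omega
        have hjlabs : |(j : ℤ) - l| ≤ ((H ^ 2 : ℕ) : ℤ) := by
          rw [abs_le]
          omega
        have h := hm (m * ((k + 1 + 1 : ℕ) * ((j : ℤ) - l)))
          (mul_ne_zero hm0 (mul_ne_zero (by positivity) hjl')) ?_
        · rw [Polynomial.taylor_sub_taylor_coeff p (k + 1) hp]
          convert h using 3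
          push_cast
          ring
        · rw [abs_mul, abs_mul, Nat.abs_cast]
          have hexp : (H ^ 2) ^ (2 ^ (k + 1) - 2) * H ^ 2 = H ^ (2 ^ (k + 1 + 1) - 2) := by
            rw [← pow_mul, ← pow_add]
            congr 1
            have : 2 ≤ 2 ^ (k + 1) := by
              rw [pow_succ]
              have := Nat.one_le_two_pow (n := k)
              omega
            rw [pow_succ 2 (k + 1)]
            omega
          calc |m| * (((k + 1 + 1 : ℕ) : ℤ) * |(j : ℤ) - l|)
              ≤ ((k + 1).factorial * (H ^ 2) ^ (2 ^ (k + 1) - 2) : ℕ)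
                * (((k + 1 + 1 : ℕ) : ℤ) * ((H ^ 2 : ℕ) : ℤ)) := by gcongr
            _ = _ := by
                rw [← hexp, Nat.factorial_succ (k + 1)]
                push_cast
                ring
    obtain ⟨T, hT0, hT, hS⟩ := vanDerCorput (fun n => p.eval (n : ℝ)) N (H ^ 2)
      ((2 * k + 1) * N / (H : ℝ) ^ 2) (by positivity) hcorr
    set S := ‖∑ n ∈ range N, expTwoPiI (p.eval (n : ℝ))‖
    push_cast at hT hS
    have hT' : T ≤ (2 * k + 2) * N * H := by
      refine abs_le_of_sq_le_sq' (hT.trans ?_) (by positivity) |>.2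
      have : (N : ℝ) * (H ^ 2 * N + (H ^ 2) ^ 2 * ((2 * k + 1) * N / (H : ℝ) ^ 2))
          = (2 * k + 2) * (N * H) ^ 2 := by
        field_simp
        ring
      rw [this]
      have hk : (0 : ℝ) ≤ k := by positivity
      nlinarith [sq_nonneg ((N : ℝ) * H), mul_nonneg hk (sq_nonneg ((N : ℝ) * H)),
        mul_nonneg (mul_nonneg hk hk) (sq_nonneg ((N : ℝ) * H))]
    -- Makes the shift error `H ^ 4` at most `H * N`; it accounts for the last unit in `2k + 3`.
    have hHN : (H : ℝ) ^ 3 ≤ N := by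
      have h2 : (H : ℝ) ^ 2 ≤ (H : ℝ) ^ 2 ^ (k + 1) :=
        pow_le_pow_right₀ hH1 (by rw [pow_succ]; have := Nat.one_le_two_pow (n := k); omega)
      have h3 : (H : ℝ) ^ 2 * H ^ 2 ≤ Q * (H : ℝ) ^ 2 ^ (k + 1) :=
        mul_le_mul (h2.trans hQ) h2 (by positivity) (le_trans (by positivity) hQ)
      have h4 : (H : ℝ) ^ 3 ≤ H ^ 4 := pow_le_pow_right₀ hH1 (by norm_num)
      nlinarith
    have h5 : (H : ℝ) * (S * H) ≤ H * ((2 * k + 3) * N) := by nlinarith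
    have h6 := le_of_mul_le_mul_left h5 hH0
    push_cast
    linarith

/-! ### From small Weyl sums to small fractional parts -/

/-- Fejér's argument: if the Weyl sums are small then some value is close to an integer. -/
lemma exists_sq_distNearestInt_mul_lt (u : ℕ → ℝ) (N H : ℕ) (hN : 0 < N) (hH : 0 < H)
    (h : ∀ m : ℤ, m ≠ 0 → |m| < H →
      ‖∑ n ∈ range N, expTwoPiI (m * u n)‖ * (2 * H) ≤ N) :
    ∃ n < N, distNearestInt (u n) ^ 2 * H < 1 := by
  by_contra! hcon
  have hN0 : (0 : ℝ) < N := by exact_mod_cast hN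
  have hH0 : (0 : ℝ) < H := by exact_mod_cast hH
  -- The mean square is at least `HN/2` by the diagonal, yet at most `HN/4` if every `‖u n‖ ≥
  -- H^(-1/2)`.
  have h1 := (abs_le.1 (abs_sum_norm_sq_sub_le (fun n j => j * u n) N H (N / (2 * H))
    (by positivity) ?_)).1
  · have h2 : ∑ n ∈ range N, ‖∑ j ∈ range H, expTwoPiI (j * u n)‖ ^ 2
        ≤ ∑ _n ∈ range N, (H / 4 : ℝ) := by
      refine Finset.sum_le_sum fun n hn => ?_
      have h3 := distNearestInt_mul_norm_sum_linear_le (u n) 0 H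
      simp only [add_zero] at h3
      set S := ‖∑ j ∈ range H, expTwoPiI (j * u n)‖
      have hS : 0 ≤ S := norm_nonneg _
      have h4 := hcon n (mem_range.1 hn)
      have h5 : (2 * distNearestInt (u n) * S) ^ 2 ≤ 1 :=
        pow_le_one₀ (by have := distNearestInt_nonneg (u n); positivity) h3
      have h6 := mul_le_mul_of_nonneg_right h4 (sq_nonneg S)
      have h7 := mul_le_mul_of_nonneg_left h5 hH0.le
      nlinarith
    rw [Finset.sum_const, card_range, nsmul_eq_mul] at h2
    have h3 : (H : ℝ) ^ 2 * (N / (2 * H)) = H * N / 2 := by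
      field_simp
    rw [h3] at h1
    nlinarith [mul_pos hN0 hH0]
  · intro j hj l hl hjl
    rw [le_div_iff₀ (by positivity)]
    have := h ((j : ℤ) - l) (by omega) (by rw [abs_lt]; omega)
    push_cast at this
    simpa [sub_mul] using this

/-- Rationals of denominator at most `T` stay some `e > 0` away from `α`; Dirichlet's approximation
of order `n > 1/e` is closer than that. -/
lemma exists_rat_approx_den_gt (α : ℝ) (hα : Irrational α) (T : ℕ) :
    ∃ r : ℚ, T < r.den ∧ |α - r| < 1 / (r.den : ℝ) ^ 2 := by
  obtain ⟨e, he, he0⟩ := (((hα.eventually_forall_le_dist_cast_rat_of_den_le T).filter_mono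
    nhdsWithin_le_nhds).and (self_mem_nhdsWithin (a := (0 : ℝ)) (s := Set.Ioi 0))).exists
  obtain ⟨n, hn⟩ := exists_nat_gt (1 / e)
  have hn0 : 0 < n := by
    have : (0 : ℝ) < n := lt_trans (by positivity) hn
    exact_mod_cast this
  obtain ⟨r, hr, hrn⟩ := Real.exists_rat_abs_sub_le_and_den_le α hn0
  have hden : (1 : ℝ) ≤ r.den := by exact_mod_cast r.pos
  have hn1 : (r.den : ℝ) ≤ n := by exact_mod_cast hrn
  refine ⟨r, ?_, hr.trans_lt ?_⟩
  · by_contra! hle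
    have h1 := he r hle
    rw [Real.dist_eq] at h1
    have h2 : 1 / (((n : ℝ) + 1) * r.den) < e := by
      rw [div_lt_iff₀ (by positivity)]
      rw [div_lt_iff₀ he0] at hn
      nlinarith [mul_le_mul_of_nonneg_left hden (by positivity : 0 ≤ e * ((n : ℝ) + 1))]
    linarith
  · apply one_div_lt_one_div_of_lt (by positivity)
    nlinarith

/-- Small multiples of a number with a rational approximation of denominator `q` stay at distance
at least `1 / (2 q)` from the integers. -/
lemma one_le_two_mul_den_mul_distNearestInt (α : ℝ) (r : ℚ)
    (hr : |α - r| < 1 / (r.den : ℝ) ^ 2) (m : ℤ) (hm : m ≠ 0) (hmr : 2 * |m| ≤ r.den) :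
    1 ≤ 2 * (r.den : ℝ) * distNearestInt (m * α) := by
  have hq0 : (0 : ℝ) < r.den := by exact_mod_cast r.pos
  set z : ℤ := round ((m : ℝ) * α) with hz
  -- By coprimality the denominator would divide `m`, which is too small. This nonzero integer
  -- differs from `q(mα - z)` by at most `1/2`.
  have hne : m * r.num - z * r.den ≠ 0 := by
    intro h0
    have hdvd : (r.den : ℤ) ∣ m * r.num := ⟨z, by linarith⟩
    have hcop : IsCoprime (r.den : ℤ) r.num := by
      rw [Int.isCoprime_iff_gcd_eq_one, Int.gcd_comm]
      simpa [Int.gcd] using r.reduced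
    have h1 := Int.le_of_dvd (abs_pos.2 hm) ((dvd_abs _ _).2 (hcop.dvd_of_dvd_mul_right hdvd))
    have := abs_pos.2 hm
    omega
  have h1 : (1 : ℝ) ≤ |((m * r.num - z * r.den : ℤ) : ℝ)| := by
    rw [← Int.cast_abs]
    exact_mod_cast Int.one_le_abs hne
  have hrr : (r : ℝ) * r.den = r.num := by exact_mod_cast Rat.mul_den_eq_num r
  have h2 : ((m * r.num - z * r.den : ℤ) : ℝ)
      = r.den * (m * α - z) - m * r.den * (α - r) := by
    push_cast
    rw [← hrr]
    ring
  have h3 : |(m : ℝ) * r.den * (α - r)| ≤ 1 / 2 := by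
    rw [abs_mul, abs_mul, abs_of_pos hq0]
    have hm2 : 2 * |(m : ℝ)| ≤ r.den := by exact_mod_cast hmr
    have h4 : |α - r| * (r.den : ℝ) ^ 2 ≤ 1 := by
      rw [lt_div_iff₀ (by positivity)] at hr
      exact hr.le
    nlinarith [mul_le_mul_of_nonneg_right hm2 (by positivity : 0 ≤ (r.den : ℝ) * |α - r|)]
  have h5 : |(r.den : ℝ) * (m * α - z)| = r.den * distNearestInt (m * α) := by
    rw [abs_mul, abs_of_pos hq0]
    rfl
  have h6 := abs_sub ((r.den : ℝ) * (m * α - z)) (m * r.den * (α - r))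
  rw [h2] at h1
  linarith

/-- Matching `q ≍ H^E` with `N ≍ q H^(2^k)` gives the exponent of `H`; `A` depends only on `k`. -/
theorem exists_distNearestInt_eval_small (k : ℕ) (g : Polynomial ℝ) (hg : g.natDegree ≤ k + 1)
    (hα : Irrational (g.coeff (k + 1))) :
    ∃ A : ℝ, 0 < A ∧ ∀ T : ℕ, ∃ H : ℕ, T < H ∧ ∃ m : ℕ,
      (m : ℝ) ≤ A * (H : ℝ) ^ (2 ^ (k + 1) - 1 + 2 ^ k) ∧
      distNearestInt (g.eval (m : ℝ)) ^ 2 * H < 1 := by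
  -- Weyl with parameter `L * H` turns its factor `2k + 1` into the saving `2H` that Fejér needs.
  obtain ⟨L, hL⟩ : ∃ L, L = 2 * (2 * k + 1) := ⟨_, rfl⟩
  obtain ⟨E, hE⟩ : ∃ E, E = 2 ^ (k + 1) - 1 := ⟨_, rfl⟩
  have h2k := Nat.one_le_two_pow (n := k)
  have hpow : 2 ^ (k + 1) = 2 * 2 ^ k := pow_succ' 2 k
  have hE1 : 1 ≤ E := by omega
  have hkE : 2 ^ k ≤ E := by omega
  have hL1 : 1 ≤ L := by omega
  -- Chosen so that `c * H ^ E ≤ q` gives `2|m h| ≤ q` for all Weyl multipliers `m` and frequencies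
  -- `|h| < H`.
  obtain ⟨c, hc⟩ : ∃ c, c = 2 * (k + 1).factorial * L ^ E := ⟨_, rfl⟩
  have hfac := Nat.factorial_pos (k + 1)
  have hLE : 1 ≤ L ^ E := Nat.one_le_pow _ _ hL1
  have hc1 : 1 ≤ c := by
    rw [hc]
    exact Nat.mul_pos (by omega) hLE
  rw [← hE]
  refine ⟨((2 * (c * 2 ^ E) * L ^ 2 ^ k : ℕ) : ℝ), by positivity, fun T => ?_⟩
  obtain ⟨r, hrT, hr⟩ := exists_rat_approx_den_gt _ hα (c * (T + 1) ^ E)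
  set q := r.den with hq
  -- Maximality gives `q ≪ H ^ E`; the search bound `q` is harmless since `h ≤ c * h ^ E`.
  obtain ⟨H, hH⟩ : ∃ H, H = Nat.findGreatest (fun h => c * h ^ E ≤ q) q := ⟨_, rfl⟩
  have hle : ∀ h : ℕ, h ≤ c * h ^ E := fun h =>
    (Nat.le_self_pow (by omega) h).trans (Nat.le_mul_of_pos_left _ hc1)
  have hTH : T + 1 ≤ H := by
    rw [hH]
    exact Nat.le_findGreatest ((hle _).trans hrT.le) hrT.le
  have hHq : c * H ^ E ≤ q := by
    rw [hH]
    exact Nat.findGreatest_spec (P := fun h => c * h ^ E ≤ q) ((hle _).trans hrT.le) hrT.le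
  have hqH : q < c * (H + 1) ^ E := by
    by_contra! hcon
    have := Nat.le_findGreatest (P := fun h => c * h ^ E ≤ q) ((hle _).trans hcon) hcon
    omega
  have hqH' : q ≤ c * 2 ^ E * H ^ E := by
    refine hqH.le.trans ?_
    rw [mul_assoc, ← mul_pow]
    gcongr
    omega
  have hH1 : 1 ≤ H := by omega
  have hq0 : 0 < q := r.pos
  set N := 2 * q * (L * H) ^ 2 ^ k with hN
  have hLH : 1 ≤ L * H := Nat.mul_pos hL1 hH1
  have hN0 : 0 < N := Nat.mul_pos (by omega) (Nat.pow_pos hLH)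
  have hLHq : 2 * (k + 1).factorial * (L * H) ^ E ≤ q := by
    rw [mul_pow, ← mul_assoc, ← hc]
    exact hHq
  have hfejer := exists_sq_distNearestInt_mul_lt (fun n => g.eval (n : ℝ)) N H hN0 hH1 ?_
  · obtain ⟨m, hmN, hm⟩ := hfejer
    refine ⟨H, by omega, m, ?_, hm⟩
    have : m ≤ 2 * (c * 2 ^ E) * L ^ 2 ^ k * H ^ (E + 2 ^ k) := by
      refine hmN.le.trans ?_
      calc N ≤ 2 * (c * 2 ^ E * H ^ E) * (L * H) ^ 2 ^ k := by
            rw [hN]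
            gcongr
        _ = _ := by
            rw [mul_pow, pow_add]
            ring
    exact_mod_cast this
  · intro h hh0 hhH
    have hw := norm_weylSum_mul_le k (L * H) N (2 * q) (Polynomial.C (h : ℝ) * g) hLH
      ((Polynomial.natDegree_C_mul_le _ _).trans hg) ?_ ?_ ?_
    · simp only [Polynomial.eval_mul, Polynomial.eval_C] at hw
      rw [hL] at hw
      push_cast at hw
      have hk : (0 : ℝ) < 2 * k + 1 := by positivity
      refine le_of_mul_le_mul_left (a := (2 * k + 1 : ℝ)) ?_ hk
      refine le_trans (le_of_eq ?_) hw
      ring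
    · intro m hm0 hm
      rw [Polynomial.coeff_C_mul, ← mul_assoc]
      have := one_le_two_mul_den_mul_distNearestInt _ r hr (m * h) (mul_ne_zero hm0 hh0) ?_
      · push_cast at this
        exact this
      · rw [abs_mul]
        calc 2 * (|m| * |h|)
            ≤ 2 * (((k + 1).factorial * (L * H) ^ (2 ^ (k + 1) - 2) : ℕ) * (L * H : ℕ)) := by
              gcongr
              refine hhH.le.trans ?_
              exact_mod_cast Nat.le_mul_of_pos_left _ hL1
          _ = ((2 * (k + 1).factorial * (L * H) ^ E : ℕ) : ℤ) := by
              have : E = 2 ^ (k + 1) - 2 + 1 := by omega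
              rw [this, pow_succ]
              push_cast
              ring
          _ ≤ q := by exact_mod_cast hLHq
    · have : (L * H) ^ 2 ^ k ≤ 2 * q := by
        calc (L * H) ^ 2 ^ k ≤ (L * H) ^ E := Nat.pow_le_pow_right hLH hkE
          _ ≤ 2 * (k + 1).factorial * (L * H) ^ E := Nat.le_mul_of_pos_left _ (by omega)
          _ ≤ 2 * q := by omega
      exact_mod_cast this
    · rw [hN]
      push_cast
      rfl

/-! ### Even integers and the final exponents -/

lemma three_le_card_divisors_two_mul (m : ℕ) (hm : 2 ≤ m) : 3 ≤ (2 * m).divisors.card := by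
  have hsub : ({1, 2, 2 * m} : Finset ℕ) ⊆ (2 * m).divisors := by
    intro d hd
    simp only [mem_insert, mem_singleton] at hd
    rw [Nat.mem_divisors]
    rcases hd with rfl | rfl | rfl
    · exact ⟨one_dvd _, by omega⟩
    · exact ⟨dvd_mul_right _ _, by omega⟩
    · exact ⟨dvd_rfl, by omega⟩
  refine le_trans (le_of_eq ?_) (card_le_card hsub)
  rw [card_insert_of_notMem, card_pair]
  · omega
  · simp only [mem_insert, mem_singleton]
    omega

lemma gammaExp_succ_div_four (k : ℕ) : gammaExp (k + 1) / 4 = 1 / 4 ^ (k + 1) := by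
  unfold gammaExp
  have : 1 - ((k + 1 : ℕ) : ℤ) = -(k : ℤ) := by push_cast; ring
  rw [this, zpow_neg, zpow_natCast, pow_succ]
  field_simp

/-- A negative power of a quantity of size at most `A * H ^ D` dominates `H ^ (-1 / 2)` once the
exponents leave room. -/
lemma exists_forall_mul_rpow_le (A : ℝ) (hA : 0 < A) (D : ℕ) (c : ℝ) (hc : 0 < c)
    (hD : D * c < 1 / 2) :
    ∃ T : ℕ, ∀ H : ℕ, T < H → ∀ n : ℝ, 0 < n → n ≤ A * (H : ℝ) ^ D →
      1 ≤ (n ^ (-c)) ^ 2 * H := by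
  have hpos : 0 < 1 - 2 * (D * c) := by linarith
  have htend := (tendsto_rpow_atTop hpos).comp (tendsto_natCast_atTop_atTop (R := ℝ))
  obtain ⟨T, hT⟩ := Filter.eventually_atTop.1 (htend.eventually_ge_atTop (A ^ (2 * c)))
  refine ⟨T, fun H hH n hn hnA => ?_⟩
  have hH0 : (0 : ℝ) < H := by exact_mod_cast (by omega : 0 < H)
  have h1 : A ^ (2 * c) ≤ (H : ℝ) ^ (1 - 2 * (D * c)) := hT H hH.le
  have h2 : n ^ (2 * c) ≤ H := by
    calc n ^ (2 * c) ≤ (A * (H : ℝ) ^ D) ^ (2 * c) :=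
          Real.rpow_le_rpow hn.le hnA (by positivity)
      _ = A ^ (2 * c) * (H : ℝ) ^ (2 * (D * c)) := by
          rw [Real.mul_rpow hA.le (by positivity), ← Real.rpow_natCast, ← Real.rpow_mul hH0.le]
          ring_nf
      _ ≤ (H : ℝ) ^ (1 - 2 * (D * c)) * (H : ℝ) ^ (2 * (D * c)) := by gcongr
      _ = H := by
          rw [← Real.rpow_add hH0]
          simp
  have h3 : (n ^ (-c)) ^ 2 = (n ^ (2 * c))⁻¹ := by
    rw [← Real.rpow_natCast, ← Real.rpow_mul hn.le, ← Real.rpow_neg hn.le]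
    congr 1
    push_cast
    ring
  rw [h3, inv_mul_eq_div, one_le_div (by positivity)]
  exact h2

theorem theorem3 (f : Polynomial ℝ) (k : ℕ) (hk : 1 ≤ k) (hdeg : f.natDegree = k)
    (hlead : Irrational f.leadingCoeff) (ε : ℝ) (hε : 0 < ε) :
    {n : ℕ | 3 ≤ n.divisors.card ∧
      distNearestInt (f.eval (n : ℝ)) < (n : ℝ) ^ (-(gammaExp k / 4) + ε)}.Infinite := by
  obtain ⟨k, rfl⟩ : ∃ j, k = j + 1 := ⟨k - 1, by omega⟩
  rw [gammaExp_succ_div_four]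
  refine Set.infinite_of_forall_exists_gt fun a => ?_
  -- The shift forces `n = 2(m + M) > a` and `m + M ≥ 2`, even when `m = 0`.
  set M := a + 2 with hM
  set l : Polynomial ℝ := Polynomial.C 2 * Polynomial.X + Polynomial.C (2 * M : ℝ) with hl
  have hldeg : l.natDegree = 1 := Polynomial.natDegree_linear two_ne_zero
  have hllead : l.leadingCoeff = 2 := Polynomial.leadingCoeff_linear two_ne_zero
  have hgdeg : (f.comp l).natDegree = k + 1 := by
    rw [Polynomial.natDegree_comp, hdeg, hldeg, mul_one]
  have hgcoeff : (f.comp l).coeff (k + 1) = f.leadingCoeff * ((2 ^ (k + 1) : ℕ) : ℝ) := by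
    rw [← hgdeg, Polynomial.coeff_natDegree, Polynomial.leadingCoeff_comp (by omega), hllead,
      hgdeg, hdeg]
    push_cast
    rfl
  obtain ⟨A, hA, hsmall⟩ := exists_distNearestInt_eval_small k (f.comp l) hgdeg.le
    (by rw [hgcoeff]; exact hlead.mul_natCast (by positivity))
  set D := 2 ^ (k + 1) - 1 + 2 ^ k with hD
  set c : ℝ := 1 / 4 ^ (k + 1) - ε with hc
  have heval : ∀ m : ℕ, (f.comp l).eval (m : ℝ) = f.eval ((2 * (m + M) : ℕ) : ℝ) := by
    intro m
    rw [Polynomial.eval_comp, hl]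
    simp
    ring_nf
  have hexp : -(1 / 4 ^ (k + 1)) + ε = -c := by rw [hc]; ring
  rw [hexp]
  suffices h : ∃ m : ℕ, distNearestInt (f.eval ((2 * (m + M) : ℕ) : ℝ))
      < ((2 * (m + M) : ℕ) : ℝ) ^ (-c) by
    obtain ⟨m, hm⟩ := h
    exact ⟨2 * (m + M), ⟨three_le_card_divisors_two_mul _ (by omega), hm⟩, by omega⟩
  -- For large `ε` the right side is at least `1`, exceeding the trivial bound `1/2`.
  rcases le_or_gt c 0 with hc0 | hc0
  · refine ⟨0, ?_⟩
    have h1 : (1 : ℝ) ≤ ((2 * (0 + M) : ℕ) : ℝ) ^ (-c) :=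
      Real.one_le_rpow (by exact_mod_cast (by omega : 1 ≤ 2 * (0 + M))) (by linarith)
    have h2 := distNearestInt_le_half (f.eval ((2 * (0 + M) : ℕ) : ℝ))
    linarith
  -- With `x = 2^k` this is `(2x - 1)(x - 1) ≥ 0`; equality holds at `k = 0`, so strictness in `hDc`
  -- comes from `ε`.
  · have hD4 : 2 * (D : ℝ) ≤ 4 ^ (k + 1) := by
      have h2k : (1 : ℝ) ≤ 2 ^ k := one_le_pow₀ (by norm_num)
      have h4k : (4 : ℝ) ^ (k + 1) = 4 * (2 ^ k) ^ 2 := by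
        rw [pow_succ, ← pow_mul, mul_comm k 2, pow_mul]
        norm_num
        ring
      have hDr : (D : ℝ) = 3 * 2 ^ k - 1 := by
        rw [hD]
        push_cast [Nat.one_le_two_pow]
        ring
      rw [h4k, hDr]
      nlinarith
    have hD0 : (0 : ℝ) < D := by
      have := Nat.one_le_two_pow (n := k)
      exact_mod_cast (by omega : 0 < D)
    have hDc : D * c < 1 / 2 := by
      have h1 : D * (1 / 4 ^ (k + 1) : ℝ) ≤ 1 / 2 := by
        rw [mul_one_div, div_le_iff₀ (by positivity)]
        linarith
      rw [hc, mul_sub]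
      nlinarith
    obtain ⟨T, hT⟩ := exists_forall_mul_rpow_le (2 * A + 2 * M) (by positivity) D c hc0 hDc
    obtain ⟨H, hTH, m, hmH, hm⟩ := hsmall T
    refine ⟨m, ?_⟩
    rw [heval] at hm
    have hH1 : (1 : ℝ) ≤ H := by exact_mod_cast (by omega : 1 ≤ H)
    have hn0 : (0 : ℝ) < ((2 * (m + M) : ℕ) : ℝ) := by exact_mod_cast (by omega)
    have hn := hT H hTH _ hn0 (by
      have h1 : (1 : ℝ) ≤ (H : ℝ) ^ D := one_le_pow₀ hH1
      have h2 : (0 : ℝ) ≤ M := by positivity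
      push_cast
      nlinarith)
    refine lt_of_pow_lt_pow_left₀ 2 (by positivity) ?_
    exact lt_of_mul_lt_mul_right (hm.trans_le hn) (by positivity)
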